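/- Let $n\ge 1$, let $D=D^n$ be the closed unit ball in $\mathbb R^n$, with boundary $\partial D$, and let $S$ be a smooth manifold diffeomorphic to $S^{n-1}$. A (not necessarily reversible) Finsler metric on $D$ is a continuous function $\phi\colon TD\to\mathbb R$ such that $\phi(tv)=t\phi(v)$ for $v\in TD$ and $t\ge 0$, $\phi$ is positive and smooth outside the zero section, and for every $x\in D$ the function $\phi^2|_{T_xD}$ has positive definite second derivative on $T_xD\setminus\{0\}$. Its dual norm is $\phi^*(\alpha)=\sup\{\alpha(v)\mid v\in T_xD,\ \phi(v)=1\}$ for $\alpha\in T_x^*D$; write $U_x^*D=\{\alpha\in T_x^*D\mid\phi^*(\alpha)=1\}$. The Holmes–Thompson volume is $$\operatorname{vol}(D,\phi)=\frac1{\omega_n}\operatorname{Vol}_{can}\{\alpha\in T^*D\mid\phi^*(\alpha)\le 1\},$$ where $\omega_n$ is the Euclidean volume of the unit ball in $\mathbb R^n$ and $\operatorname{Vol}_{can}$ is the canonical symplectic volume on $T^*D$. A smooth function $F\colon S\times D\to\mathbb R$ is an enveloping function for $\phi$ if, with $F_p=F(p,\cdot)$, (i) $\phi^*(d_xF_p)=1$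 for all $p\in S$ and $x\in D$, and (ii) for every $x\in D$ the map $p\mapsto d_xF_p$ is a diffeomorphism from $S$ onto $U_x^*D$. Then the volume is determined by the boundary values of an enveloping function: if $F_1,F_2\colon S\times D\to\mathbb R$ are enveloping functions for Finsler metrics $\phi_1,\phi_2$ on $D$, respectively, and $F_1|_{S\times\partial D}=F_2|_{S\times\partial D}$, then $\operatorname{vol}(D,\phi_1)=\operatorname{vol}(D,\phi_2)$. -/

import Mathlib

open Set Metric MeasureTheory
open scoped Manifold ContDiff

/-- The ambient Euclidean space `ℝⁿ` of the standard disc. -/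
abbrev EucSpace (n : ℕ) : Type := EuclideanSpace ℝ (Fin n)

/-- The dual of `ℝⁿ`: the fibre `Tₓ*D` of the cotangent bundle at each point of the disc. -/
abbrev Covec (n : ℕ) : Type := StrongDual ℝ (EucSpace n)

/-- The `n`-dimensional disc `D = Dⁿ`, the closed unit ball of `ℝⁿ`. -/
def disc (n : ℕ) : Set (EucSpace n) := closedBall 0 1

/-- The boundary `∂D` of the disc, the unit sphere of `ℝⁿ`. -/
def discBoundary (n : ℕ) : Set (EucSpace n) := sphere 0 1

/-- `φ x v`, for `x ∈ D` and `v ∈ TₓD = ℝⁿ`, is a (not necessarily reversible) Finsler metric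
on `D`. Only the values of `φ` at base points `x ∈ D` matter. -/
structure IsFinslerMetric {n : ℕ} (φ : EucSpace n → EucSpace n → ℝ) : Prop where
  /-- `φ` is continuous on `TD = D × ℝⁿ`. -/
  continuousOn : ContinuousOn (Function.uncurry φ) (disc n ×ˢ univ)
  /-- `φ` is positively homogeneous on the fibres. -/
  homogeneous : ∀ x ∈ disc n, ∀ v : EucSpace n, ∀ t : ℝ, 0 ≤ t → φ x (t • v) = t * φ x v
  /-- `φ` is positive off the zero section. -/
  pos : ∀ x ∈ disc n, ∀ v : EucSpace n, v ≠ 0 → 0 < φ x v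
  /-- `φ` is smooth (up to the boundary of `D`) off the zero section. -/
  smooth : ContDiffOn ℝ ∞ (Function.uncurry φ) (disc n ×ˢ {0}ᶜ)
  /-- On each fibre, `φ²` has positive definite second derivative off the origin. -/
  strictlyConvex : ∀ x ∈ disc n, ∀ v : EucSpace n, v ≠ 0 → ∀ w : EucSpace n, w ≠ 0 →
    0 < iteratedFDeriv ℝ 2 (fun u => φ x u ^ 2) v ![w, w]

/-- The dual norm `φ*(α) = sup {α(v) | φ(v) = 1}` on `Tₓ*D` of the norm `ν = φ|TₓD`. -/
noncomputable def dualNorm {n : ℕ} (ν : EucSpace n → ℝ) (α : Covec n) : ℝ :=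
  sSup {r | ∃ v : EucSpace n, ν v = 1 ∧ α v = r}

/-- The unit sphere `Uₓ*D` of the dual norm at `x`. -/
def unitCosphere {n : ℕ} (φ : EucSpace n → EucSpace n → ℝ) (x : EucSpace n) : Set (Covec n) :=
  {α | dualNorm (φ x) α = 1}

/-- The bundle `B*D ⊆ T*D = D × (ℝⁿ)*` of unit balls of the dual norms. -/
def unitCoballBundle {n : ℕ} (φ : EucSpace n → EucSpace n → ℝ) : Set (EucSpace n × Covec n) :=
  {z | z.1 ∈ disc n ∧ dualNorm (φ z.1) z.2 ≤ 1}

/-- The canonical (symplectic) volume on `T*ℝⁿ = ℝⁿ × (ℝⁿ)*`: Lebesgue measure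
`dx₁ ⋯ dxₙ dξ₁ ⋯ dξₙ` in the canonical coordinates `xᵢ`, `ξᵢ = α(eᵢ)`. The covector with
coordinates `ξ` is `v ↦ ⟪ξ, v⟫`, which is `InnerProductSpace.toDual ℝ _ ξ`. -/
noncomputable def canonicalVolume (n : ℕ) : Measure (EucSpace n × Covec n) :=
  Measure.map (Prod.map id (InnerProductSpace.toDual ℝ (EucSpace n)))
    (volume : Measure (EucSpace n × EucSpace n))

/-- The Holmes–Thompson volume `vol(D, φ) = Vol_can(B*D) / ωₙ`, where `ωₙ` is the Euclidean
volume of the unit ball of `ℝⁿ`. -/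
noncomputable def holmesThompsonVolume {n : ℕ} (φ : EucSpace n → EucSpace n → ℝ) : ENNReal :=
  canonicalVolume n (unitCoballBundle φ) / volume (closedBall (0 : EucSpace n) 1)

/-- The differential `dₓf ∈ Tₓ*D` of a function on the disc (one-sided at boundary points). -/
noncomputable def diffAt {n : ℕ} (f : EucSpace n → ℝ) (x : EucSpace n) : Covec n :=
  fderivWithin ℝ f (disc n) x

/-- `f : D → ℝ` is distance-like with respect to `φ`: it is smooth on `D` and
`φ*(dₓf) = 1` for all `x ∈ D`. -/
structure IsDistanceLike {n : ℕ} (φ : EucSpace n → EucSpace n → ℝ) (f : EucSpace n → ℝ) :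
    Prop where
  smooth : ContDiffOn ℝ ∞ f (disc n)
  dualNorm_eq_one : ∀ x ∈ disc n, dualNorm (φ x) (diffAt f x) = 1

/-- `G` is a diffeomorphism from the manifold `S` onto the subset `U` of the vector space `V`:
it is a smooth bijection of `S` onto `U` with smooth inverse. -/
structure IsDiffeoOnto {m : ℕ} {S : Type*} [TopologicalSpace S]
    [ChartedSpace (EuclideanSpace ℝ (Fin m)) S]
    {V : Type*} [NormedAddCommGroup V] [NormedSpace ℝ V] (G : S → V) (U : Set V) : Prop where
  smooth : ContMDiff (𝓡 m) 𝓘(ℝ, V) ∞ G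
  range_eq : range G = U
  smooth_inverse : ∃ g : V → S, ContMDiffOn 𝓘(ℝ, V) (𝓡 m) ∞ g U ∧ ∀ p, g (G p) = p

/-- `F : S × D → ℝ` (`F p x` for `p ∈ S`, `x ∈ D`) is an enveloping function for `φ`.
Only the values of `F p` on `D` matter. -/
structure IsEnveloping {m n : ℕ} {S : Type*} [TopologicalSpace S]
    [ChartedSpace (EuclideanSpace ℝ (Fin m)) S]
    (φ : EucSpace n → EucSpace n → ℝ) (F : S → EucSpace n → ℝ) : Prop where
  /-- `F` is smooth on `S × D`, up to the boundary of `D`. -/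
  smooth : ContMDiffOn ((𝓡 m).prod 𝓘(ℝ, EucSpace n)) 𝓘(ℝ, ℝ) ∞ (Function.uncurry F)
    (univ ×ˢ disc n)
  /-- Every `F p` is distance-like. -/
  distanceLike : ∀ p : S, IsDistanceLike φ (F p)
  /-- For every `x ∈ D`, the map `p ↦ dₓ(F p)` is a diffeomorphism from `S` to `Uₓ*D`. -/
  diffeo : ∀ x ∈ disc n, IsDiffeoOnto (m := m) (fun p : S => diffAt (F p) x) (unitCosphere φ x)

/-!
The unit cospheres are parametrized by the sphere through the diffeomorphism `p ↦ dₓF_p`. Extending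
homogeneously, put `K (y, x) = ‖y‖ F (y / ‖y‖, x)` for `y ≠ 0`, with `S` identified with the unit
sphere. For each `x ∈ D` the map `y ↦ dₓK (y, ·)` is a bijection of the punctured unit ball onto the
punctured dual unit ball at `x`, so by the change of variables formula and Tonelli's theorem

  `Vol (B*D) = ∫_{0 < ‖y‖ ≤ 1} ∫_D |det ∂ᵧ∂ₓK (y, x)| dx dy`

(`IsPolarGenerating.canonicalVolume_unitCoballBundle`). By the symmetry of second derivatives, the
integrand is, for fixed `y`, the absolute value of the Jacobian determinant of the map
`x ↦ ∂ᵧK (y, x)` on the disc. It does not vanish (`IsPolarGenerating.det_mixedHessian_ne_zero`), so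
it has a constant sign on the disc, and the inner integral is, up to sign, the integral of a
Jacobian determinant. The latter is a null Lagrangian: its integral depends only on the values of
`∂ᵧK (y, ·)` on the boundary, and these are determined by the boundary values of `F`.

The null Lagrangian property (`integral_det_fderiv_eq_of_eqOn_sphere`) holds because, for maps `G₁`
and `G₂` with the same boundary values and for large `t`, the maps `t • id + G₁` and `t • id + G₂`
are injective on the ball and have the same image (`image_ball_smul_add_eq`). Hence the integrals of
`det (t + DG₁)` and `det (t + DG₂)` agree for large `t`. As these are polynomials in `t` of bounded
degree, they agree at `t = 0`.
-/

/-! ### The Jacobian determinant is a null Lagrangian -/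

section NullLagrangian

variable {E : Type*} [NormedAddCommGroup E] [NormedSpace ℝ E]

/-- The radial retraction of a normed space onto its closed unit ball. -/
noncomputable def radialRetraction (x : E) : E := (max 1 ‖x‖)⁻¹ • x

theorem radialRetraction_of_mem {x : E} (hx : x ∈ closedBall (0 : E) 1) :
    radialRetraction x = x := by
  have : ‖x‖ ≤ 1 := by simpa using hx
  simp [radialRetraction, max_eq_left this]

theorem radialRetraction_mem_closedBall (x : E) :
    radialRetraction x ∈ closedBall (0 : E) 1 := by
  have h : 0 < max 1 ‖x‖ := lt_of_lt_of_le one_pos (le_max_left _ _)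
  rw [mem_closedBall_zero_iff, radialRetraction, norm_smul, norm_inv, Real.norm_of_nonneg h.le,
    inv_mul_le_iff₀ h]
  simp

theorem radialRetraction_mem_sphere {x : E} (hx : x ∉ ball (0 : E) 1) :
    radialRetraction x ∈ sphere (0 : E) 1 := by
  have h : 1 ≤ ‖x‖ := by simpa using hx
  rw [mem_sphere_zero_iff_norm, radialRetraction, norm_smul, norm_inv, max_eq_right h, norm_norm,
    inv_mul_cancel₀ (by positivity)]

theorem lipschitzWith_radialRetraction : LipschitzWith 2 (radialRetraction : E → E) := by
  refine LipschitzWith.of_dist_le_mul fun x y => ?_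
  rw [dist_eq_norm, dist_eq_norm]
  set a := max 1 ‖x‖ with ha
  set b := max 1 ‖y‖ with hb
  have ha1 : 1 ≤ a := le_max_left _ _
  have hb1 : 1 ≤ b := le_max_left _ _
  have hab : |b - a| ≤ ‖x - y‖ := by
    have h1 : |b - a| ≤ |‖y‖ - ‖x‖| := by
      simpa [ha, hb, max_comm] using abs_max_sub_max_le_abs ‖y‖ ‖x‖ 1
    rw [norm_sub_rev x y]
    exact h1.trans (abs_norm_sub_norm_le y x)
  have ha0 : 0 < a := by linarith
  have hb0 : 0 < b := by linarith
  have h1 : radialRetraction x - radialRetraction y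
      = a⁻¹ • (x - y) + (a⁻¹ * (b - a) * b⁻¹) • y := by
    have : a⁻¹ * (b - a) * b⁻¹ = a⁻¹ - b⁻¹ := by field_simp
    rw [this, radialRetraction, radialRetraction, sub_smul, smul_sub]
    abel
  have h2 : b⁻¹ * ‖y‖ ≤ 1 := by
    rw [inv_mul_le_iff₀ hb0, mul_one]; exact le_max_right _ _
  have h3 : a⁻¹ ≤ 1 := inv_le_one_of_one_le₀ ha1
  rw [h1]
  calc ‖a⁻¹ • (x - y) + (a⁻¹ * (b - a) * b⁻¹) • y‖
      ≤ a⁻¹ * ‖x - y‖ + a⁻¹ * |b - a| * (b⁻¹ * ‖y‖) := by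
        refine (norm_add_le _ _).trans (le_of_eq ?_)
        rw [norm_smul, norm_smul, norm_mul, norm_mul, norm_inv, norm_inv,
          Real.norm_of_nonneg ha0.le, Real.norm_of_nonneg hb0.le, Real.norm_eq_abs]
        ring
    _ ≤ 1 * ‖x - y‖ + 1 * ‖x - y‖ * 1 := by gcongr
    _ = ((2 : NNReal) : ℝ) * ‖x - y‖ := by push_cast; ring

/-- A perturbation of `t • id` by a map with Lipschitz constant below `t` is bijective. -/
theorem bijective_smul_add [CompleteSpace E] {f : E → E} {c : NNReal} (hf : LipschitzWith c f)
    {t : ℝ} (ht : c < t) : Function.Bijective fun x => t • x + f x := by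
  have ht0 : 0 < t := c.coe_nonneg.trans_lt ht
  constructor
  · intro x y hxy
    have h1 : t • (x - y) = f y - f x := by
      simp only at hxy
      rw [smul_sub, sub_eq_sub_iff_add_eq_add, hxy, add_comm]
    have h2 : t * dist x y ≤ c * dist x y := by
      have := hf.dist_le_mul y x
      rwa [dist_eq_norm, ← h1, norm_smul, Real.norm_of_nonneg ht0.le, ← dist_eq_norm,
        dist_comm y x] at this
    by_contra hne
    have := dist_pos.2 hne
    nlinarith
  · intro w
    -- a preimage of `w` is a fixed point of the contraction `x ↦ t⁻¹ (w - f x)`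
    let k : NNReal := c / t.toNNReal
    have hk : ContractingWith k fun x => t⁻¹ • (w - f x) := by
      refine ⟨?_, LipschitzWith.of_dist_le_mul fun x y => ?_⟩
      · rw [div_lt_one (by simpa using ht0)]
        rw [← NNReal.coe_lt_coe, Real.coe_toNNReal _ ht0.le]
        exact ht
      · rw [dist_smul₀, dist_sub_left, Real.norm_of_nonneg (inv_nonneg.2 ht0.le)]
        have := hf.dist_le_mul x y
        rw [NNReal.coe_div, Real.coe_toNNReal _ ht0.le, div_eq_inv_mul, mul_assoc]
        gcongr
    refine ⟨hk.fixedPoint, ?_⟩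
    have h := hk.fixedPoint_isFixedPt
    have h2 : t⁻¹ • (w - f hk.fixedPoint) = hk.fixedPoint := h
    have h3 : w - f hk.fixedPoint = t • hk.fixedPoint := by
      rw [← h2, smul_inv_smul₀ ht0.ne', h2]
    simp only
    rw [← h3, sub_add_cancel]

theorem lipschitzWith_comp_radialRetraction {G : E → E} {c : NNReal}
    (hG : LipschitzOnWith c G (closedBall 0 1)) :
    LipschitzWith (c * 2) (G ∘ radialRetraction) := by
  rw [← lipschitzOnWith_univ]
  exact hG.comp lipschitzWith_radialRetraction.lipschitzOnWith
    fun x _ => radialRetraction_mem_closedBall x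

theorem injOn_smul_add [CompleteSpace E] {G : E → E} {c : NNReal}
    (hG : LipschitzOnWith c G (closedBall 0 1)) {t : ℝ} (ht : (c * 2 : NNReal) < t) :
    InjOn (fun x => t • x + G x) (ball 0 1) := by
  refine (bijective_smul_add (lipschitzWith_comp_radialRetraction hG) ht).1.injOn.congr ?_
  intro x hx
  simp [radialRetraction_of_mem (ball_subset_closedBall hx)]

/-- Two large multiples of the identity perturbed by maps with the same boundary values have the
same image of the ball: extended by the radial retraction, they are bijections of the space that
agree outside of the ball. -/
theorem image_ball_smul_add_eq [CompleteSpace E] {G₁ G₂ : E → E} {c : NNReal}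
    (h₁ : LipschitzOnWith c G₁ (closedBall 0 1)) (h₂ : LipschitzOnWith c G₂ (closedBall 0 1))
    (h : EqOn G₁ G₂ (sphere 0 1)) {t : ℝ} (ht : (c * 2 : NNReal) < t) :
    (fun x => t • x + G₁ x) '' ball 0 1 = (fun x => t • x + G₂ x) '' ball 0 1 := by
  have key : ∀ {G : E → E}, LipschitzOnWith c G (closedBall 0 1) →
      (fun x => t • x + G x) '' ball 0 1
        = ((fun x => t • x + (G ∘ radialRetraction) x) '' (ball 0 1)ᶜ)ᶜ := by
    intro G hG
    rw [image_compl_eq (bijective_smul_add (lipschitzWith_comp_radialRetraction hG) ht),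
      compl_compl]
    refine image_congr fun x hx => ?_
    simp [radialRetraction_of_mem (ball_subset_closedBall hx)]
  rw [key h₁, key h₂]
  congr 1
  refine image_congr fun x hx => ?_
  simp [h (radialRetraction_mem_sphere hx)]

variable [FiniteDimensional ℝ E]

/-- The determinant of `t • id + A` is positive for `t` above the norm of `A`. -/
theorem det_smul_id_add_pos {A : E →L[ℝ] E} {t : ℝ} (ht : ‖A‖ < t) :
    0 < (t • ContinuousLinearMap.id ℝ E + A).det := by
  have ht0 : 0 < t := (norm_nonneg A).trans_lt ht
  have hne : ∀ s ∈ Icc (0 : ℝ) 1, (t • ContinuousLinearMap.id ℝ E + s • A).det ≠ 0 := by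
    intro s hs h0
    obtain ⟨v, hv, hv0⟩ :=
      (Submodule.ne_bot_iff _).1 (LinearMap.bot_lt_ker_of_det_eq_zero h0).ne'
    have h1 : t • v + s • A v = 0 := by simpa using hv
    have h2 : t * ‖v‖ = s * ‖A v‖ := by
      have := congrArg norm (eq_neg_of_add_eq_zero_left h1)
      rwa [norm_neg, norm_smul, norm_smul, Real.norm_of_nonneg ht0.le,
        Real.norm_of_nonneg hs.1] at this
    have h3 : ‖A v‖ ≤ ‖A‖ * ‖v‖ := A.le_opNorm v
    have h4 : 0 < ‖v‖ := norm_pos_iff.2 hv0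
    have h5 : s * ‖A v‖ ≤ 1 * ‖A v‖ := by gcongr; exact hs.2
    nlinarith
  have hc : Continuous fun s : ℝ => (t • ContinuousLinearMap.id ℝ E + s • A).det :=
    ContinuousLinearMap.continuous_det.comp (by fun_prop)
  by_contra hneg
  have h0 : 0 < (t • ContinuousLinearMap.id ℝ E + (0 : ℝ) • A).det := by
    have : (t • ContinuousLinearMap.id ℝ E + (0 : ℝ) • A).det = t ^ Module.finrank ℝ E := by
      simp [ContinuousLinearMap.det]
    rw [this]; positivity
  obtain ⟨s, hs, hs0⟩ := intermediate_value_Icc' (zero_le_one' ℝ) hc.continuousOn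
    (show (0 : ℝ) ∈ Icc _ _ from ⟨by simpa using hneg, h0.le⟩)
  exact hne s hs hs0

/-- The determinant of `A` is a fixed linear combination of determinants of `t • id + A` with
arbitrarily large `t`: it is the value at `0` of a polynomial in `t` of fixed degree. -/
theorem exists_det_eq_sum (a : ℝ) :
    ∃ (s : Finset ℕ) (t w : ℕ → ℝ), (∀ i, a < t i) ∧ ∀ A : E →L[ℝ] E,
      A.det = ∑ i ∈ s, w i * (t i • ContinuousLinearMap.id ℝ E + A).det := by
  let t : ℕ → ℝ := fun i => |a| + 1 + i
  let s := Finset.range (Module.finrank ℝ E + 1)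
  have hinj : InjOn t s := fun i _ j _ hij => by simpa [t] using hij
  refine ⟨s, t, fun i => (Lagrange.basis s t i).eval 0, fun i => ?_, fun A => ?_⟩
  · have := le_abs_self a
    have : (0 : ℝ) ≤ i := i.cast_nonneg
    simp only [t]; linarith
  have hev : ∀ r : ℝ, (LinearMap.charpoly (-(A : E →ₗ[ℝ] E))).eval r
      = (r • ContinuousLinearMap.id ℝ E + A).det := by
    intro r
    rw [LinearMap.eval_charpoly, ContinuousLinearMap.det]
    congr 1
    ext x
    simp [Module.algebraMap_end_apply]
  have hdeg : (LinearMap.charpoly (-(A : E →ₗ[ℝ] E))).degree < s.card := by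
    rw [Polynomial.degree_eq_natDegree (LinearMap.charpoly_monic _).ne_zero,
      LinearMap.charpoly_natDegree]
    simp only [s, Finset.card_range]
    exact_mod_cast Nat.lt_succ_self _
  have h := congrArg (Polynomial.eval 0) (Lagrange.eq_interpolate hinj hdeg)
  rw [hev, Lagrange.interpolate_apply, Polynomial.eval_finsetSum] at h
  simp only [zero_smul, zero_add] at h
  rw [h]
  refine Finset.sum_congr rfl fun i _ => ?_
  rw [Polynomial.eval_mul, Polynomial.eval_C, hev, mul_comm]

variable [MeasurableSpace E] [BorelSpace E]

/-- **The Jacobian determinant is a null Lagrangian**: its integral over the unit ball depends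
only on the boundary values of the map. -/
theorem integral_det_fderiv_eq_of_eqOn_sphere (μ : Measure E) [μ.IsAddHaarMeasure]
    {G₁ G₂ : E → E} (h₁ : ContDiffOn ℝ 1 G₁ (closedBall 0 1))
    (h₂ : ContDiffOn ℝ 1 G₂ (closedBall 0 1)) (h : EqOn G₁ G₂ (sphere 0 1)) :
    ∫ x in ball 0 1, (fderiv ℝ G₁ x).det ∂μ = ∫ x in ball 0 1, (fderiv ℝ G₂ x).det ∂μ := by
  have hud : UniqueDiffOn ℝ (closedBall (0 : E) 1) :=
    uniqueDiffOn_convex (convex_closedBall 0 1)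
      ⟨0, ball_subset_interior_closedBall (mem_ball_self one_pos)⟩
  have hnhds : ∀ x ∈ ball (0 : E) 1, closedBall (0 : E) 1 ∈ nhds x := fun x hx =>
    Filter.mem_of_superset (isOpen_ball.mem_nhds hx) ball_subset_closedBall
  -- a common bound for both derivatives
  have hbd : ∀ {G : E → E}, ContDiffOn ℝ 1 G (closedBall 0 1) →
      ∃ C : NNReal, ∀ x ∈ closedBall (0 : E) 1, ‖fderivWithin ℝ G (closedBall 0 1) x‖₊ ≤ C := by
    intro G hG
    obtain ⟨C, hC⟩ := (isCompact_closedBall (0 : E) 1).exists_bound_of_continuousOn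
      (hG.continuousOn_fderivWithin hud le_rfl)
    exact ⟨C.toNNReal, fun x hx => by
      rw [← NNReal.coe_le_coe]; exact (hC x hx).trans (Real.le_coe_toNNReal C)⟩
  obtain ⟨C₁, hC₁⟩ := hbd h₁
  obtain ⟨C₂, hC₂⟩ := hbd h₂
  set C := max C₁ C₂ with hC
  obtain ⟨s, t, w, ht, hdet⟩ := exists_det_eq_sum (E := E) ((C * 2 : NNReal) : ℝ)
  have hCt : ∀ i, (C : ℝ) < t i := fun i => lt_of_le_of_lt
    (by exact_mod_cast le_mul_of_one_le_right C.2 one_le_two) (ht i)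
  -- the area formula for `t • id + G`
  have harea : ∀ {G : E → E}, ContDiffOn ℝ 1 G (closedBall 0 1) →
      (∀ x ∈ closedBall (0 : E) 1, ‖fderivWithin ℝ G (closedBall 0 1) x‖₊ ≤ C) → ∀ i,
      LipschitzOnWith C G (closedBall 0 1) ∧
      IntegrableOn (fun x => (t i • ContinuousLinearMap.id ℝ E + fderiv ℝ G x).det) (ball 0 1) μ ∧
      ∫ x in ball 0 1, (t i • ContinuousLinearMap.id ℝ E + fderiv ℝ G x).det ∂μ
        = (μ ((fun x => t i • x + G x) '' ball 0 1)).toReal := by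
    intro G hG hGC i
    have hlip : LipschitzOnWith C G (closedBall 0 1) :=
      (convex_closedBall (0 : E) 1).lipschitzOnWith_of_nnnorm_fderivWithin_le
        (hG.differentiableOn one_ne_zero) hGC
    have heq : ∀ x ∈ ball (0 : E) 1, fderivWithin ℝ G (closedBall 0 1) x = fderiv ℝ G x :=
      fun x hx => fderivWithin_of_mem_nhds (hnhds x hx)
    refine ⟨hlip, ?_, ?_⟩
    · have hcont : ContinuousOn (fun x =>
          (t i • ContinuousLinearMap.id ℝ E + fderivWithin ℝ G (closedBall 0 1) x).det)
          (closedBall 0 1) :=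
        ContinuousLinearMap.continuous_det.comp_continuousOn
          (continuousOn_const.add (hG.continuousOn_fderivWithin hud le_rfl))
      refine ((hcont.integrableOn_compact (isCompact_closedBall _ _)).mono_set
        ball_subset_closedBall).congr_fun (fun x hx => ?_) measurableSet_ball
      simp only [heq x hx]
    · have hderiv : ∀ x ∈ ball (0 : E) 1, HasFDerivWithinAt (fun x => t i • x + G x)
          (t i • ContinuousLinearMap.id ℝ E + fderiv ℝ G x) (ball 0 1) x := by
        intro x hx
        have hd : DifferentiableAt ℝ G x :=
          (hG.contDiffAt (hnhds x hx)).differentiableAt one_ne_zero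
        exact (((hasFDerivAt_id x).const_smul (t i)).add hd.hasFDerivAt).hasFDerivWithinAt
      have := integral_image_eq_integral_abs_det_fderiv_smul μ measurableSet_ball hderiv
        (injOn_smul_add hlip (ht i)) (fun _ => (1 : ℝ))
      simp only [integral_const, smul_eq_mul, mul_one, measureReal_restrict_apply_univ] at this
      rw [← Measure.real, this]
      refine setIntegral_congr_fun measurableSet_ball fun x hx => ?_
      rw [abs_of_pos]
      refine det_smul_id_add_pos (lt_of_le_of_lt ?_ (hCt i))
      rw [← heq x hx]
      exact_mod_cast hGC x (ball_subset_closedBall hx)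
  have H₁ := harea h₁ fun x hx => (hC₁ x hx).trans (le_max_left _ _)
  have H₂ := harea h₂ fun x hx => (hC₂ x hx).trans (le_max_right _ _)
  rw [setIntegral_congr_fun measurableSet_ball fun x _ => hdet (fderiv ℝ G₁ x),
    setIntegral_congr_fun measurableSet_ball fun x _ => hdet (fderiv ℝ G₂ x),
    integral_finsetSum _ fun i _ => (H₁ i).2.1.const_mul (w i),
    integral_finsetSum _ fun i _ => (H₂ i).2.1.const_mul (w i)]
  refine Finset.sum_congr rfl fun i _ => ?_
  rw [integral_const_mul, integral_const_mul, (H₁ i).2.2, (H₂ i).2.2,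
    image_ball_smul_add_eq (H₁ i).1 (H₂ i).1 h (ht i)]

/-- If the Jacobian determinants do not vanish in the ball, also the integral of their absolute
values depends only on the boundary values: each has a constant sign. -/
theorem lintegral_abs_det_fderiv_eq_of_eqOn_sphere (μ : Measure E) [μ.IsAddHaarMeasure]
    {G₁ G₂ : E → E} (h₁ : ContDiffOn ℝ 1 G₁ (closedBall 0 1))
    (h₂ : ContDiffOn ℝ 1 G₂ (closedBall 0 1)) (h : EqOn G₁ G₂ (sphere 0 1))
    (hd₁ : ∀ x ∈ ball (0 : E) 1, (fderiv ℝ G₁ x).det ≠ 0)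
    (hd₂ : ∀ x ∈ ball (0 : E) 1, (fderiv ℝ G₂ x).det ≠ 0) :
    ∫⁻ x in ball 0 1, ENNReal.ofReal |(fderiv ℝ G₁ x).det| ∂μ
      = ∫⁻ x in ball 0 1, ENNReal.ofReal |(fderiv ℝ G₂ x).det| ∂μ := by
  have key : ∀ {G : E → E}, ContDiffOn ℝ 1 G (closedBall 0 1) →
      (∀ x ∈ ball (0 : E) 1, (fderiv ℝ G x).det ≠ 0) →
      ∫⁻ x in ball 0 1, ENNReal.ofReal |(fderiv ℝ G x).det| ∂μ
        = ENNReal.ofReal |∫ x in ball 0 1, (fderiv ℝ G x).det ∂μ| := by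
    intro G hG hd
    have hud : UniqueDiffOn ℝ (closedBall (0 : E) 1) :=
      uniqueDiffOn_convex (convex_closedBall 0 1)
        ⟨0, ball_subset_interior_closedBall (mem_ball_self one_pos)⟩
    have hcont' : ContinuousOn (fun x => (fderivWithin ℝ G (closedBall 0 1) x).det)
        (closedBall 0 1) :=
      ContinuousLinearMap.continuous_det.comp_continuousOn
        (hG.continuousOn_fderivWithin hud le_rfl)
    have heq : EqOn (fun x => (fderivWithin ℝ G (closedBall 0 1) x).det)
        (fun x => (fderiv ℝ G x).det) (ball 0 1) := fun x hx => by
      simp only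
      rw [fderivWithin_of_mem_nhds (Filter.mem_of_superset (isOpen_ball.mem_nhds hx)
        ball_subset_closedBall)]
    have hint : IntegrableOn (fun x => (fderiv ℝ G x).det) (ball 0 1) μ :=
      ((hcont'.integrableOn_compact (isCompact_closedBall _ _)).mono_set
        ball_subset_closedBall).congr_fun heq measurableSet_ball
    have hcont : ContinuousOn (fun x => (fderiv ℝ G x).det) (ball 0 1) :=
      (hcont'.mono ball_subset_closedBall).congr heq.symm
    rw [← ofReal_integral_eq_lintegral_ofReal hint.abs (Filter.Eventually.of_forall fun _ =>
      abs_nonneg _)]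
    congr 1
    have hsign : (∀ x ∈ ball (0 : E) 1, 0 ≤ (fderiv ℝ G x).det) ∨
        (∀ x ∈ ball (0 : E) 1, (fderiv ℝ G x).det ≤ 0) := by
      by_contra hcon
      push Not at hcon
      obtain ⟨⟨x, hx, hx0⟩, ⟨y, hy, hy0⟩⟩ := hcon
      obtain ⟨z, hz, hz0⟩ := (convex_ball (0 : E) 1).isPreconnected.intermediate_value hx hy hcont
        ⟨hx0.le, hy0.le⟩
      exact hd z hz hz0
    rcases hsign with hs | hs
    · rw [abs_of_nonneg (setIntegral_nonneg measurableSet_ball hs)]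
      exact setIntegral_congr_fun measurableSet_ball fun x hx => abs_of_nonneg (hs x hx)
    · rw [abs_of_nonpos (setIntegral_nonpos measurableSet_ball hs), ← integral_neg]
      exact setIntegral_congr_fun measurableSet_ball fun x hx => abs_of_nonpos (hs x hx)
  rw [key h₁ hd₁, key h₂ hd₂, integral_det_fderiv_eq_of_eqOn_sphere μ h₁ h₂ h]

end NullLagrangian

/-! ### The dual norm -/

section DualNorm

variable {m : ℕ} {ν : EucSpace (m + 1) → ℝ}

/-- `ν` is a continuous, positively homogeneous, positive function: a possibly asymmetric norm,
except that it need not satisfy the triangle inequality. -/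
structure IsGauge (ν : EucSpace (m + 1) → ℝ) : Prop where
  continuous : Continuous ν
  homogeneous : ∀ v : EucSpace (m + 1), ∀ t : ℝ, 0 ≤ t → ν (t • v) = t * ν v
  pos : ∀ v : EucSpace (m + 1), v ≠ 0 → 0 < ν v

theorem IsFinslerMetric.isGauge {φ : EucSpace (m + 1) → EucSpace (m + 1) → ℝ}
    (hφ : IsFinslerMetric φ) {x : EucSpace (m + 1)} (hx : x ∈ disc (m + 1)) : IsGauge (φ x) where
  continuous := by
    rw [← continuousOn_univ]
    exact hφ.continuousOn.comp (by fun_prop : Continuous fun v => (x, v)).continuousOn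
      fun v _ => ⟨hx, mem_univ v⟩
  homogeneous := hφ.homogeneous x hx
  pos := hφ.pos x hx

namespace IsGauge

theorem map_inv_smul (hν : IsGauge ν) {v : EucSpace (m + 1)} (hv : v ≠ 0) :
    ν ((ν v)⁻¹ • v) = 1 := by
  rw [hν.homogeneous v _ (inv_nonneg.2 (hν.pos v hv).le), inv_mul_cancel₀ (hν.pos v hv).ne']

theorem nonempty_indicatrix (hν : IsGauge ν) : {v | ν v = 1}.Nonempty := by
  obtain ⟨v, hv⟩ := exists_ne (0 : EucSpace (m + 1))
  exact ⟨_, hν.map_inv_smul hv⟩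

theorem isCompact_indicatrix (hν : IsGauge ν) : IsCompact {v | ν v = 1} := by
  refine isCompact_of_isClosed_isBounded (isClosed_eq hν.continuous continuous_const) ?_
  obtain ⟨w, hw, hmin⟩ := (isCompact_sphere (0 : EucSpace (m + 1)) 1).exists_isMinOn
    (NormedSpace.sphere_nonempty.2 zero_le_one) hν.continuous.continuousOn
  have hc : 0 < ν w := hν.pos w (ne_zero_of_mem_unit_sphere ⟨w, hw⟩)
  refine (isBounded_closedBall (x := (0 : EucSpace (m + 1))) (r := (ν w)⁻¹)).subset fun v hv => ?_
  rw [mem_closedBall_zero_iff]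
  rcases eq_or_ne v 0 with rfl | hv0
  · simpa using hc.le
  have hn : 0 < ‖v‖ := norm_pos_iff.2 hv0
  have h1 : ν w ≤ ν (‖v‖⁻¹ • v) := hmin (by simp [norm_smul, hn.ne'])
  rw [hν.homogeneous v _ (inv_nonneg.2 hn.le), show ν v = 1 from hv, mul_one] at h1
  exact (le_inv_comm₀ hc hn).1 h1

theorem isCompact_values (hν : IsGauge ν) (α : Covec (m + 1)) :
    IsCompact {r | ∃ v : EucSpace (m + 1), ν v = 1 ∧ α v = r} :=
  hν.isCompact_indicatrix.image α.continuous

theorem le_dualNorm (hν : IsGauge ν) (α : Covec (m + 1)) {v : EucSpace (m + 1)} (hv : ν v = 1) :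
    α v ≤ dualNorm ν α :=
  le_csSup (hν.isCompact_values α).bddAbove ⟨v, hv, rfl⟩

/-- The supremum defining the dual norm is attained. -/
theorem exists_eq_dualNorm (hν : IsGauge ν) (α : Covec (m + 1)) :
    ∃ v, ν v = 1 ∧ α v = dualNorm ν α :=
  (hν.isCompact_values α).sSup_mem (hν.nonempty_indicatrix.image α)

theorem dualNorm_pos (hν : IsGauge ν) {α : Covec (m + 1)} (hα : α ≠ 0) : 0 < dualNorm ν α := by
  obtain ⟨v, hv⟩ : ∃ v, 0 < α v := by
    obtain ⟨v, hv⟩ := ContinuousLinearMap.exists_ne_zero hα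
    rcases hv.lt_or_gt with h | h
    · exact ⟨-v, by simpa using h⟩
    · exact ⟨v, h⟩
  have hv0 : v ≠ 0 := by rintro rfl; simp at hv
  refine lt_of_lt_of_le ?_ (hν.le_dualNorm α (hν.map_inv_smul hv0))
  rw [map_smul, smul_eq_mul]
  exact mul_pos (inv_pos.2 (hν.pos v hv0)) hv

end IsGauge

theorem dualNorm_smul (ν : EucSpace (m + 1) → ℝ) {c : ℝ} (hc : 0 ≤ c) (α : Covec (m + 1)) :
    dualNorm ν (c • α) = c * dualNorm ν α := by
  rw [dualNorm, dualNorm, ← smul_eq_mul c, ← Real.sSup_smul_of_nonneg hc]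
  congr 1
  ext r
  simp only [mem_ofPred_eq, mem_smul_set]
  constructor
  · rintro ⟨v, hv, rfl⟩
    exact ⟨α v, ⟨v, hv, rfl⟩, rfl⟩
  · rintro ⟨_, ⟨v, hv, rfl⟩, rfl⟩
    exact ⟨v, hv, rfl⟩

end DualNorm

/-! ### Mixed second derivatives of functions on `(ℝⁿ \ {0}) × D` -/

section Calculus

/-- The identification of covectors with vectors of `ℝⁿ` by the inner product. It is the inverse of
`InnerProductSpace.toDual`, as an isometry that is linear over `ℝ` instead of conjugate-linear. -/
noncomputable def covecEquiv (n : ℕ) : Covec n ≃ₗᵢ[ℝ] EucSpace n where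
  toFun := (InnerProductSpace.toDual ℝ (EucSpace n)).symm
  invFun := InnerProductSpace.toDual ℝ (EucSpace n)
  map_add' := map_add _
  map_smul' c α := by simp
  left_inv α := by simp
  right_inv v := by simp
  norm_map' α := by simp

theorem covecEquiv_symm_eq_toDual (n : ℕ) :
    ⇑(covecEquiv n).symm = InnerProductSpace.toDual ℝ (EucSpace n) := rfl

theorem inner_covecEquiv {n : ℕ} (α : Covec n) (v : EucSpace n) :
    inner ℝ (covecEquiv n α) v = α v :=
  InnerProductSpace.toDual_symm_apply

theorem det_eq_of_inner_eq {E : Type*} [NormedAddCommGroup E] [InnerProductSpace ℝ E]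
    [FiniteDimensional ℝ E] {A B : E →L[ℝ] E} (h : ∀ u v, inner ℝ (A u) v = inner ℝ u (B v)) :
    A.det = B.det := by
  have hA : (A : E →ₗ[ℝ] E) = LinearMap.adjoint (B : E →ₗ[ℝ] E) :=
    (LinearMap.eq_adjoint_iff _ _).2 h
  let b := stdOrthonormalBasis ℝ E
  rw [ContinuousLinearMap.det, ContinuousLinearMap.det, hA, ← LinearMap.det_toMatrix b.toBasis,
    ← LinearMap.det_toMatrix b.toBasis, LinearMap.toMatrix_adjoint, Matrix.det_conjTranspose]
  simp

theorem uniqueDiffOn_disc (n : ℕ) : UniqueDiffOn ℝ (disc n) :=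
  uniqueDiffOn_convex (convex_closedBall 0 1)
    ⟨0, ball_subset_interior_closedBall (mem_ball_self one_pos)⟩

theorem disc_mem_nhds {n : ℕ} {x : EucSpace n} (hx : x ∈ ball (0 : EucSpace n) 1) :
    disc n ∈ nhds x :=
  Filter.mem_of_superset (isOpen_ball.mem_nhds hx) ball_subset_closedBall

variable {n : ℕ} {K : EucSpace n × EucSpace n → ℝ}

/-- The differential of `K` in the second variable, over the disc, seen as a vector. -/
noncomputable def baseGrad (K : EucSpace n × EucSpace n → ℝ) (y x : EucSpace n) : EucSpace n :=
  covecEquiv n (diffAt (fun x => K (y, x)) x)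

/-- The differential of `K` in the first variable, seen as a vector. -/
noncomputable def paramGrad (K : EucSpace n × EucSpace n → ℝ) (y x : EucSpace n) : EucSpace n :=
  covecEquiv n (fderiv ℝ (fun y => K (y, x)) y)

/-- The mixed second derivative `∂ᵧ∂ₓK`, seen as an endomorphism of `ℝⁿ`. -/
noncomputable def mixedHessian (K : EucSpace n × EucSpace n → ℝ) (z : EucSpace n × EucSpace n) :
    EucSpace n →L[ℝ] EucSpace n :=
  ((covecEquiv n).toContinuousLinearEquiv : Covec n →L[ℝ] EucSpace n) ∘L
    (ContinuousLinearMap.compL ℝ (EucSpace n) (EucSpace n × EucSpace n) ℝ).flip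
      (ContinuousLinearMap.inr ℝ (EucSpace n) (EucSpace n)) ∘L
    fderiv ℝ (fderiv ℝ K) z ∘L ContinuousLinearMap.inl ℝ (EucSpace n) (EucSpace n)

theorem fderivWithin_eq_fderiv_of_mem_ball {y x : EucSpace n} (hy : y ≠ 0)
    (hx : x ∈ ball (0 : EucSpace n) 1) :
    fderivWithin ℝ K ({0}ᶜ ×ˢ disc n) (y, x) = fderiv ℝ K (y, x) :=
  fderivWithin_of_mem_nhds
    (prod_mem_nhds (isOpen_compl_singleton.mem_nhds hy) (disc_mem_nhds hx))

variable (hK : ContDiffOn ℝ ∞ K ({0}ᶜ ×ˢ disc n))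
include hK

theorem hasFDerivWithinAt_of_contDiffOn {y x : EucSpace n} (hy : y ≠ 0) (hx : x ∈ disc n) :
    HasFDerivWithinAt K (fderivWithin ℝ K ({0}ᶜ ×ˢ disc n) (y, x)) ({0}ᶜ ×ˢ disc n) (y, x) :=
  ((hK.differentiableOn (by simp)) (y, x) ⟨hy, hx⟩).hasFDerivWithinAt

theorem diffAt_eq_fderivWithin_comp_inr {y x : EucSpace n} (hy : y ≠ 0) (hx : x ∈ disc n) :
    diffAt (fun x => K (y, x)) x = fderivWithin ℝ K ({0}ᶜ ×ˢ disc n) (y, x) ∘L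
      ContinuousLinearMap.inr ℝ (EucSpace n) (EucSpace n) := by
  have h := HasFDerivWithinAt.comp (s := disc n) (f := fun x => (y, x)) x
    (hasFDerivWithinAt_of_contDiffOn hK hy hx)
    (hasFDerivAt_prodMk_right y x).hasFDerivWithinAt (fun x' hx' => ⟨hy, hx'⟩)
  exact h.fderivWithin (uniqueDiffOn_disc n x hx)

theorem hasFDerivAt_param {y x : EucSpace n} (hy : y ≠ 0) (hx : x ∈ disc n) :
    HasFDerivAt (fun y => K (y, x)) (fderivWithin ℝ K ({0}ᶜ ×ˢ disc n) (y, x) ∘L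
      ContinuousLinearMap.inl ℝ (EucSpace n) (EucSpace n)) y := by
  have h := HasFDerivWithinAt.comp (s := {0}ᶜ) (f := fun y => (y, x)) y
    (hasFDerivWithinAt_of_contDiffOn hK hy hx)
    (hasFDerivAt_prodMk_left y x).hasFDerivWithinAt (fun y' hy' => ⟨hy', hx⟩)
  exact h.hasFDerivAt (isOpen_compl_singleton.mem_nhds hy)

theorem contDiffOn_fderivWithin_disc :
    ContDiffOn ℝ ∞ (fderivWithin ℝ K ({0}ᶜ ×ˢ disc n)) ({0}ᶜ ×ˢ disc n) :=
  hK.fderivWithin (isOpen_compl_singleton.uniqueDiffOn.prod (uniqueDiffOn_disc n)) (by simp)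

theorem contDiffOn_paramGrad {y : EucSpace n} (hy : y ≠ 0) :
    ContDiffOn ℝ 1 (paramGrad K y) (disc n) := by
  have h1 : ContDiffOn ℝ ∞ (fun x => fderivWithin ℝ K ({0}ᶜ ×ˢ disc n) (y, x)) (disc n) :=
    (contDiffOn_fderivWithin_disc hK).comp (contDiff_prodMk_right y).contDiffOn
      fun x hx => ⟨hy, hx⟩
  have h2 : ContDiffOn ℝ ∞ (fun x => covecEquiv n (fderivWithin ℝ K ({0}ᶜ ×ˢ disc n) (y, x) ∘L
      ContinuousLinearMap.inl ℝ (EucSpace n) (EucSpace n))) (disc n) :=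
    (covecEquiv n).contDiff.comp_contDiffOn (h1.clm_comp contDiffOn_const)
  refine (h2.congr fun x hx => ?_).of_le (by simp)
  rw [paramGrad, (hasFDerivAt_param hK hy hx).fderiv]

theorem continuousOn_baseGrad :
    ContinuousOn (Function.uncurry (baseGrad K)) ({0}ᶜ ×ˢ disc n) := by
  have h2 : ContDiffOn ℝ ∞ (fun z => covecEquiv n (fderivWithin ℝ K ({0}ᶜ ×ˢ disc n) z ∘L
      ContinuousLinearMap.inr ℝ (EucSpace n) (EucSpace n))) ({0}ᶜ ×ˢ disc n) :=
    (covecEquiv n).contDiff.comp_contDiffOn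
      ((contDiffOn_fderivWithin_disc hK).clm_comp contDiffOn_const)
  refine h2.continuousOn.congr fun z hz => ?_
  rw [Function.uncurry, baseGrad, diffAt_eq_fderivWithin_comp_inr hK hz.1 hz.2]

theorem contDiffAt_of_mem_ball {y x : EucSpace n} (hy : y ≠ 0)
    (hx : x ∈ ball (0 : EucSpace n) 1) : ContDiffAt ℝ ∞ K (y, x) :=
  hK.contDiffAt (prod_mem_nhds (isOpen_compl_singleton.mem_nhds hy) (disc_mem_nhds hx))

theorem differentiableAt_fderiv {y x : EucSpace n} (hy : y ≠ 0)
    (hx : x ∈ ball (0 : EucSpace n) 1) : DifferentiableAt ℝ (fderiv ℝ K) (y, x) :=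
  ((contDiffAt_of_mem_ball hK hy hx).fderiv_right (m := 1) (by norm_cast)).differentiableAt
    one_ne_zero

theorem continuousOn_mixedHessian :
    ContinuousOn (mixedHessian K) (({0}ᶜ : Set (EucSpace n)) ×ˢ ball (0 : EucSpace n) 1) := by
  have ho : IsOpen (({0}ᶜ : Set (EucSpace n)) ×ˢ ball (0 : EucSpace n) 1) :=
    isOpen_compl_singleton.prod isOpen_ball
  have h1 : ContDiffOn ℝ ∞ K (({0}ᶜ : Set (EucSpace n)) ×ˢ ball (0 : EucSpace n) 1) :=
    hK.mono (prod_mono_right ball_subset_closedBall)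
  have h2 : ContDiffOn ℝ ∞ (fderiv ℝ K) (({0}ᶜ : Set (EucSpace n)) ×ˢ ball (0 : EucSpace n) 1) :=
    h1.fderiv_of_isOpen ho (by simp)
  have h3 : ContinuousOn (fderiv ℝ (fderiv ℝ K))
      (({0}ᶜ : Set (EucSpace n)) ×ˢ ball (0 : EucSpace n) 1) :=
    h2.continuousOn_fderiv_of_isOpen ho (by simp)
  exact continuousOn_const.clm_comp (continuousOn_const.clm_comp (h3.clm_comp continuousOn_const))

/-- The mixed Hessian is the derivative of the base gradient in the parameter. -/
theorem hasFDerivAt_baseGrad {y x : EucSpace n} (hy : y ≠ 0)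
    (hx : x ∈ ball (0 : EucSpace n) 1) :
    HasFDerivAt (fun y => baseGrad K y x) (mixedHessian K (y, x)) y := by
  have h1 : HasFDerivAt (fun y => fderiv ℝ K (y, x)) (fderiv ℝ (fderiv ℝ K) (y, x) ∘L
      ContinuousLinearMap.inl ℝ (EucSpace n) (EucSpace n)) y :=
    HasFDerivAt.comp y (g := fderiv ℝ K) (differentiableAt_fderiv hK hy hx).hasFDerivAt
      (hasFDerivAt_prodMk_left y x)
  have h2 := (((covecEquiv n).toContinuousLinearEquiv : Covec n →L[ℝ] EucSpace n) ∘L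
    (ContinuousLinearMap.compL ℝ (EucSpace n) (EucSpace n × EucSpace n) ℝ).flip
      (ContinuousLinearMap.inr ℝ (EucSpace n) (EucSpace n))).hasFDerivAt.comp y h1
  refine h2.congr_of_eventuallyEq ?_
  filter_upwards [isOpen_compl_singleton.mem_nhds hy] with y' hy'
  rw [baseGrad, diffAt_eq_fderivWithin_comp_inr hK hy' (ball_subset_closedBall hx),
    fderivWithin_eq_fderiv_of_mem_ball hy' hx]
  rfl

/-- By the symmetry of second derivatives, the mixed Hessian is also the transposed derivative of
the parameter gradient in the base point. -/
theorem det_fderiv_paramGrad {y x : EucSpace n} (hy : y ≠ 0)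
    (hx : x ∈ ball (0 : EucSpace n) 1) :
    (fderiv ℝ (paramGrad K y) x).det = (mixedHessian K (y, x)).det := by
  have h1 : HasFDerivAt (fun x => fderiv ℝ K (y, x)) (fderiv ℝ (fderiv ℝ K) (y, x) ∘L
      ContinuousLinearMap.inr ℝ (EucSpace n) (EucSpace n)) x :=
    HasFDerivAt.comp x (g := fderiv ℝ K) (differentiableAt_fderiv hK hy hx).hasFDerivAt
      (hasFDerivAt_prodMk_right y x)
  have h2 := (((covecEquiv n).toContinuousLinearEquiv : Covec n →L[ℝ] EucSpace n) ∘L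
    (ContinuousLinearMap.compL ℝ (EucSpace n) (EucSpace n × EucSpace n) ℝ).flip
      (ContinuousLinearMap.inl ℝ (EucSpace n) (EucSpace n))).hasFDerivAt.comp x h1
  have h3 := h2.congr_of_eventuallyEq (f₁ := paramGrad K y) (by
    filter_upwards [isOpen_ball.mem_nhds hx] with x' hx'
    rw [paramGrad, (hasFDerivAt_param hK hy (ball_subset_closedBall hx')).fderiv,
      fderivWithin_eq_fderiv_of_mem_ball hy hx']
    rfl)
  rw [h3.fderiv]
  have hsymm : IsSymmSndFDerivAt ℝ K (y, x) :=
    (contDiffAt_of_mem_ball hK hy hx).isSymmSndFDerivAt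
      (by rw [minSmoothness_of_isRCLikeNormedField]
          exact WithTop.coe_le_coe.2 (le_top : (2 : ℕ∞) ≤ ⊤))
  refine det_eq_of_inner_eq fun u v => ?_
  have e1 := inner_covecEquiv (fderiv ℝ (fderiv ℝ K) (y, x) (0, u) ∘L
    ContinuousLinearMap.inl ℝ (EucSpace n) (EucSpace n)) v
  have e2 := inner_covecEquiv (fderiv ℝ (fderiv ℝ K) (y, x) (v, 0) ∘L
    ContinuousLinearMap.inr ℝ (EucSpace n) (EucSpace n)) u
  exact (e1.trans ((hsymm (0, u) (v, 0)).trans e2.symm)).trans (real_inner_comm _ _)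

end Calculus

/-! ### Homogeneous generating functions -/

section PolarGenerating

variable {m : ℕ} {φ : EucSpace (m + 1) → EucSpace (m + 1) → ℝ}
  {K : EucSpace (m + 1) × EucSpace (m + 1) → ℝ}

/-- `K` is a family `K (y, ·)` of functions on the disc, smooth for `y ≠ 0`, that is positively
homogeneous in `y` (so it vanishes for `y = 0`), such that for each `x ∈ D` the covectors
`dₓK (y, ·)` with `‖y‖ = 1` run through the unit cosphere of `φ` at `x`, with a differentiable
inverse. It is the extension of an enveloping function parametrized by the unit sphere to all
vectors. -/
structure IsPolarGenerating (φ : EucSpace (m + 1) → EucSpace (m + 1) → ℝ)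
    (K : EucSpace (m + 1) × EucSpace (m + 1) → ℝ) : Prop where
  contDiffOn : ContDiffOn ℝ ∞ K ({0}ᶜ ×ˢ disc (m + 1))
  homogeneous : ∀ t : ℝ, 0 < t → ∀ y x, K (t • y, x) = t * K (y, x)
  dualNorm_eq_one : ∀ x ∈ disc (m + 1), ∀ y, ‖y‖ = 1 →
    dualNorm (φ x) (diffAt (fun x => K (y, x)) x) = 1
  surj : ∀ x ∈ disc (m + 1), ∀ α ∈ unitCosphere φ x,
    ∃ y, ‖y‖ = 1 ∧ diffAt (fun x => K (y, x)) x = α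
  leftInv : ∀ x ∈ disc (m + 1), ∃ L : Covec (m + 1) → EucSpace (m + 1),
    DifferentiableOn ℝ L (unitCosphere φ x) ∧
      ∀ y, ‖y‖ = 1 → L (diffAt (fun x => K (y, x)) x) = y

theorem norm_inv_norm_smul_self {E : Type*} [NormedAddCommGroup E] [NormedSpace ℝ E] {y : E}
    (hy : y ≠ 0) : ‖‖y‖⁻¹ • y‖ = 1 :=
  norm_smul_inv_norm (𝕜 := ℝ) hy

namespace IsPolarGenerating

variable (hK : IsPolarGenerating φ K)
include hK

theorem diffAt_smul {t : ℝ} (ht : 0 < t) {y x : EucSpace (m + 1)} (hy : y ≠ 0)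
    (hx : x ∈ disc (m + 1)) :
    diffAt (fun x => K (t • y, x)) x = t • diffAt (fun x => K (y, x)) x := by
  have hd : DifferentiableWithinAt ℝ (fun x => K (y, x)) (disc (m + 1)) x :=
    ((hK.contDiffOn.comp (contDiff_prodMk_right y).contDiffOn
      fun x hx => ⟨hy, hx⟩).differentiableOn (by simp)) x hx
  simp only [diffAt, hK.homogeneous t ht]
  exact fderivWithin_const_smul (uniqueDiffOn_disc _ x hx) hd t

theorem dualNorm_eq {y x : EucSpace (m + 1)} (hy : y ≠ 0) (hx : x ∈ disc (m + 1)) :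
    dualNorm (φ x) (diffAt (fun x => K (y, x)) x) = ‖y‖ := by
  have hn : 0 < ‖y‖ := norm_pos_iff.2 hy
  have h1 : ‖‖y‖⁻¹ • y‖ = 1 := norm_inv_norm_smul_self hy
  have h2 := hK.dualNorm_eq_one x hx _ h1
  rw [hK.diffAt_smul (inv_pos.2 hn) hy hx, dualNorm_smul _ (inv_nonneg.2 hn.le)] at h2
  exact (inv_mul_eq_one₀ hn.ne').1 h2 |>.symm

theorem baseGrad_injOn {x : EucSpace (m + 1)} (hx : x ∈ disc (m + 1)) :
    InjOn (fun y => baseGrad K y x) {0}ᶜ := by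
  intro y hy y' hy' h
  have h1 : diffAt (fun x => K (y, x)) x = diffAt (fun x => K (y', x)) x :=
    (covecEquiv (m + 1)).injective h
  have hn : ‖y‖ = ‖y'‖ := by rw [← hK.dualNorm_eq hy hx, h1, hK.dualNorm_eq hy' hx]
  have hy0 : 0 < ‖y‖ := norm_pos_iff.2 hy
  obtain ⟨L, -, hL⟩ := hK.leftInv x hx
  have e1 := hL (‖y‖⁻¹ • y) (norm_inv_norm_smul_self hy)
  have e2 := hL (‖y‖⁻¹ • y') (by rw [hn]; exact norm_inv_norm_smul_self hy')
  rw [hK.diffAt_smul (inv_pos.2 hy0) hy hx, h1] at e1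
  rw [hK.diffAt_smul (inv_pos.2 hy0) hy' hx, e1] at e2
  exact smul_right_injective _ (inv_ne_zero hy0.ne') e2

theorem image_baseGrad (hφ : IsFinslerMetric φ) {x : EucSpace (m + 1)} (hx : x ∈ disc (m + 1)) :
    (fun y => baseGrad K y x) '' (closedBall 0 1 \ {0})
      = {ξ | dualNorm (φ x) ((covecEquiv (m + 1)).symm ξ) ≤ 1} \ {0} := by
  ext ξ
  constructor
  · rintro ⟨y, ⟨hy1, hy0⟩, rfl⟩
    have h := hK.dualNorm_eq hy0 hx
    refine ⟨?_, fun h0 => ?_⟩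
    · simp only [baseGrad, mem_ofPred_eq, LinearIsometryEquiv.symm_apply_apply, h]
      simpa using hy1
    · have h1 : diffAt (fun x => K (y, x)) x = 0 := by
        simpa [baseGrad] using h0
      rw [h1, ← zero_smul ℝ (0 : Covec (m + 1)), dualNorm_smul _ le_rfl, zero_mul] at h
      exact hy0 (norm_eq_zero.1 h.symm)
  · rintro ⟨h1, h0⟩
    have hα : (covecEquiv (m + 1)).symm ξ ≠ 0 := by simpa using h0
    have hr := (hφ.isGauge hx).dualNorm_pos hα
    set α := (covecEquiv (m + 1)).symm ξ with hαdef
    set r := dualNorm (φ x) α with hrdef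
    obtain ⟨y, hy1, hy⟩ := hK.surj x hx (r⁻¹ • α) (by
      rw [unitCosphere, mem_ofPred_eq, dualNorm_smul _ (inv_nonneg.2 hr.le),
        inv_mul_cancel₀ hr.ne'])
    have hy0 : y ≠ 0 := by rintro rfl; simp at hy1
    refine ⟨r • y, ⟨?_, smul_ne_zero hr.ne' hy0⟩, ?_⟩
    · rw [mem_closedBall_zero_iff, norm_smul, hy1, mul_one, Real.norm_of_nonneg hr.le]
      exact h1
    · simp only [baseGrad]
      rw [hK.diffAt_smul hr hy0 hx, hy, smul_inv_smul₀ hr.ne', hαdef,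
        LinearIsometryEquiv.apply_symm_apply]

/-- `y ↦ dₓK (y, ·)` is an immersion off the origin. Indeed let `u` be in the kernel of its
derivative at `y`. If the dual norm of `dₓK (y, ·)` is attained at `v`, then
`‖y'‖ - dₓK (y', ·) v` has a minimum at `y`, so that the norm has derivative zero along `u`. Hence
`u` is tangent to the sphere, where the map has a differentiable left inverse. -/
theorem det_mixedHessian_ne_zero (hφ : IsFinslerMetric φ) {y x : EucSpace (m + 1)} (hy : y ≠ 0)
    (hx : x ∈ ball (0 : EucSpace (m + 1)) 1) : (mixedHessian K (y, x)).det ≠ 0 := by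
  intro h0
  have hxD : x ∈ disc (m + 1) := ball_subset_closedBall hx
  obtain ⟨u, hu, hu0⟩ := (Submodule.ne_bot_iff _).1 (LinearMap.bot_lt_ker_of_det_eq_zero h0).ne'
  have hu : mixedHessian K (y, x) u = 0 := hu
  refine hu0 ?_
  have hn : 0 < ‖y‖ := norm_pos_iff.2 hy
  have hyn : {0}ᶜ ∈ nhds y := isOpen_compl_singleton.mem_nhds hy
  have hgrad := hasFDerivAt_baseGrad hK.contDiffOn hy hx
  have hnorm : HasFDerivAt (fun y : EucSpace (m + 1) => ‖y‖) (fderiv ℝ (fun y => ‖y‖) y) y :=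
    (differentiableAt_id.norm ℝ hy).hasFDerivAt
  -- the norm is stationary at `y` along `u`
  have hstat : fderiv ℝ (fun y : EucSpace (m + 1) => ‖y‖) y u = 0 := by
    obtain ⟨v, hv1, hv⟩ := (hφ.isGauge hxD).exists_eq_dualNorm (diffAt (fun x => K (y, x)) x)
    rw [hK.dualNorm_eq hy hxD] at hv
    have hmin : IsLocalMin (fun y' => ‖y'‖ - inner ℝ v (baseGrad K y' x)) y := by
      filter_upwards [hyn] with y' hy'
      rw [real_inner_comm, real_inner_comm (baseGrad K y' x), baseGrad, baseGrad,
        inner_covecEquiv, inner_covecEquiv, hv, sub_self, sub_nonneg, ← hK.dualNorm_eq hy' hxD]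
      exact (hφ.isGauge hxD).le_dualNorm _ hv1
    have hz := hmin.hasFDerivAt_eq_zero (hnorm.sub ((innerSL ℝ v).hasFDerivAt.comp y hgrad))
    have := DFunLike.congr_fun hz u
    simpa [hu] using this
  -- differentiating `L (dₓK (y / ‖y‖, ·)) = y / ‖y‖` along `u` gives `u = 0`
  obtain ⟨L, hL, hLy⟩ := hK.leftInv x hxD
  obtain ⟨c, hc, hcu⟩ : ∃ c : StrongDual ℝ (EucSpace (m + 1)),
      HasFDerivAt (fun y : EucSpace (m + 1) => ‖y‖⁻¹) c y ∧ c u = 0 :=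
    ⟨_, (hasDerivAt_inv hn.ne').comp_hasFDerivAt y hnorm, by simp [hstat]⟩
  have hΨ : HasFDerivAt (fun y => diffAt (fun x => K (y, x)) x)
      (((covecEquiv (m + 1)).symm.toContinuousLinearEquiv :
        EucSpace (m + 1) →L[ℝ] Covec (m + 1)) ∘L mixedHessian K (y, x)) y := by
    refine (((covecEquiv (m + 1)).symm.toContinuousLinearEquiv :
        EucSpace (m + 1) →L[ℝ] Covec (m + 1)).hasFDerivAt.comp y hgrad).congr_of_eventuallyEq
      (Filter.Eventually.of_forall fun y' => ?_)
    simp [baseGrad]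
  have hmem : ∀ y' : EucSpace (m + 1), y' ≠ 0 →
      ‖y'‖⁻¹ • diffAt (fun x => K (y', x)) x = diffAt (fun x => K (‖y'‖⁻¹ • y', x)) x :=
    fun y' hy' => (hK.diffAt_smul (inv_pos.2 (norm_pos_iff.2 hy')) hy' hxD).symm
  have hcos : ∀ y' : EucSpace (m + 1), y' ≠ 0 →
      ‖y'‖⁻¹ • diffAt (fun x => K (y', x)) x ∈ unitCosphere φ x := fun y' hy' => by
    rw [hmem y' hy']
    exact hK.dualNorm_eq_one x hxD _ (norm_inv_norm_smul_self hy')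
  have hcomp := (HasFDerivWithinAt.comp (s := {0}ᶜ)
    (f := fun y' => ‖y'‖⁻¹ • diffAt (fun x => K (y', x)) x) y
    (hL _ (hcos y hy)).hasFDerivWithinAt (hc.smul hΨ).hasFDerivWithinAt
    (fun y' hy' => hcos y' hy')).hasFDerivAt hyn
  have hdir : HasFDerivAt (fun y' : EucSpace (m + 1) => ‖y'‖⁻¹ • y')
      (‖y‖⁻¹ • ContinuousLinearMap.id ℝ (EucSpace (m + 1)) + c.smulRight y) y :=
    hc.smul (hasFDerivAt_id y)
  have huniq := hcomp.unique (hdir.congr_of_eventuallyEq (by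
    filter_upwards [hyn] with y' hy'
    rw [Function.comp_apply, hmem y' hy', hLy _ (norm_inv_norm_smul_self hy')]))
  have := DFunLike.congr_fun huniq u
  simpa [hu, hcu, hn.ne'] using this.symm

end IsPolarGenerating

end PolarGenerating

/-! ### The volume in terms of a generating function -/

section Volume

/-- The canonical volume is the product of Lebesgue measures in the coordinates `(x, ξ)`. -/
theorem canonicalVolume_apply (n : ℕ) (s : Set (EucSpace n × Covec n)) :
    canonicalVolume n s = (volume : Measure (EucSpace n × EucSpace n))
      (Prod.map id (covecEquiv n).symm ⁻¹' s) := by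
  rw [canonicalVolume, ← covecEquiv_symm_eq_toDual]
  exact ((Homeomorph.refl (EucSpace n)).prodCongr
    (covecEquiv n).symm.toHomeomorph).toMeasurableEquiv.map_apply s

namespace IsPolarGenerating

variable {m : ℕ} {φ : EucSpace (m + 1) → EucSpace (m + 1) → ℝ}
  {K : EucSpace (m + 1) × EucSpace (m + 1) → ℝ}

/-- The volume of the unit coball bundle, computed in the coordinates `(x, y)` by the change of
variables `ξ = dₓK (y, ·)` in each fibre. The inner integrals are then over the disc. -/
theorem canonicalVolume_unitCoballBundle (hK : IsPolarGenerating φ K) (hφ : IsFinslerMetric φ) :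
    canonicalVolume (m + 1) (unitCoballBundle φ) =
      ∫⁻ y in closedBall (0 : EucSpace (m + 1)) 1 \ {0}, ∫⁻ x in ball (0 : EucSpace (m + 1)) 1,
        ENNReal.ofReal |(fderiv ℝ (paramGrad K y) x).det| := by
  set Y : Set (EucSpace (m + 1)) := closedBall 0 1 \ {0} with hYdef
  set B : Set (EucSpace (m + 1)) := ball 0 1 with hBdef
  have hYm : MeasurableSet Y := measurableSet_closedBall.diff (measurableSet_singleton 0)
  have hBm : MeasurableSet B := measurableSet_ball
  have hYsub : Y ⊆ {0}ᶜ := fun y hy => hy.2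
  set Θ : EucSpace (m + 1) × EucSpace (m + 1) → EucSpace (m + 1) × EucSpace (m + 1) :=
    fun z => (z.1, baseGrad K z.2 z.1) with hΘ
  set P : Set (EucSpace (m + 1) × EucSpace (m + 1)) := Θ '' (B ×ˢ Y) with hPdef
  -- the image of an injective continuous map of a Borel set is Borel
  have hPm : MeasurableSet P := by
    refine (hBm.prod hYm).image_of_continuousOn_injOn ?_ ?_
    · refine continuousOn_fst.prodMk ?_
      exact (continuousOn_baseGrad hK.contDiffOn).comp continuous_swap.continuousOn
        fun z hz => ⟨hYsub hz.2, ball_subset_closedBall hz.1⟩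
    · rintro ⟨x, y⟩ ⟨hx, hy⟩ ⟨x', y'⟩ ⟨hx', hy'⟩ h
      obtain ⟨rfl, h2⟩ := Prod.mk.inj h
      exact Prod.ext rfl (hK.baseGrad_injOn (ball_subset_closedBall hx) (hYsub hy) (hYsub hy') h2)
  have hslice : ∀ x ∈ B, Prod.mk x ⁻¹' P = (fun y => baseGrad K y x) '' Y := by
    intro x hx
    ext ξ
    constructor
    · rintro ⟨⟨x', y⟩, ⟨-, hy⟩, h⟩
      obtain ⟨rfl, h2⟩ := Prod.mk.inj h
      exact ⟨y, hy, h2⟩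
    · rintro ⟨y, hy, rfl⟩
      exact ⟨(x, y), ⟨hx, hy⟩, rfl⟩
  have hslice' : ∀ x ∉ B, Prod.mk x ⁻¹' P = ∅ := by
    intro x hx
    rw [eq_empty_iff_forall_notMem]
    rintro ξ ⟨⟨x', y⟩, ⟨hx', -⟩, h⟩
    obtain ⟨rfl, -⟩ := Prod.mk.inj h
    exact hx hx'
  -- up to the zero section and the fibres over the boundary, `P` is the coball bundle
  have hae : Prod.map id (covecEquiv (m + 1)).symm ⁻¹' (unitCoballBundle φ)
      =ᵐ[(volume : Measure (EucSpace (m + 1) × EucSpace (m + 1)))] P := by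
    have hnull : (volume : Measure (EucSpace (m + 1) × EucSpace (m + 1)))
        ((sphere 0 1 ×ˢ univ) ∪ (univ ×ˢ {0})) = 0 := by
      rw [Measure.volume_eq_prod]
      refine measure_union_null ?_ ?_
      · rw [Measure.prod_prod, Measure.addHaar_sphere, zero_mul]
      · rw [Measure.prod_prod, measure_singleton, mul_zero]
    filter_upwards [measure_eq_zero_iff_ae_notMem.1 hnull] with z hz
    obtain ⟨x, ξ⟩ := z
    have hxs : x ∉ sphere (0 : EucSpace (m + 1)) 1 := fun h => hz (Or.inl ⟨h, mem_univ _⟩)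
    have hξ : ξ ≠ 0 := fun h => hz (Or.inr ⟨mem_univ _, h⟩)
    refine propext ?_
    change (x ∈ disc (m + 1) ∧ dualNorm (φ x) ((covecEquiv (m + 1)).symm ξ) ≤ 1) ↔
      ξ ∈ Prod.mk x ⁻¹' P
    by_cases hx : x ∈ B
    · have hxD : x ∈ disc (m + 1) := ball_subset_closedBall hx
      rw [hslice x hx, hYdef, hK.image_baseGrad hφ hxD]
      simp [hxD, hξ]
    · rw [hslice' x hx]
      simp only [mem_empty_iff_false, iff_false, not_and]
      intro hxD
      exact absurd (le_antisymm (mem_closedBall.1 hxD) (not_lt.1 hx)) hxs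
  have hmeas : AEMeasurable (Function.uncurry fun x y : EucSpace (m + 1) =>
      ENNReal.ofReal |(mixedHessian K (y, x)).det|)
      ((volume.restrict B).prod (volume.restrict Y)) := by
    rw [Measure.prod_restrict]
    refine ContinuousOn.aemeasurable ?_ (hBm.prod hYm)
    refine ENNReal.continuous_ofReal.comp_continuousOn (continuous_abs.comp_continuousOn
      (ContinuousLinearMap.continuous_det.comp_continuousOn
        ((continuousOn_mixedHessian hK.contDiffOn).comp continuous_swap.continuousOn
          fun z hz => ⟨hYsub hz.2, hz.1⟩)))
  rw [canonicalVolume_apply, measure_congr hae, Measure.volume_eq_prod, Measure.prod_apply hPm]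
  have hind : (fun x => volume (Prod.mk x ⁻¹' P)) =
      B.indicator fun x => ∫⁻ y in Y, ENNReal.ofReal |(mixedHessian K (y, x)).det| := by
    ext x
    by_cases hx : x ∈ B
    · rw [indicator_of_mem hx, hslice x hx]
      exact (lintegral_abs_det_fderiv_eq_addHaar_image volume hYm
        (fun y hy => (hasFDerivAt_baseGrad hK.contDiffOn (hYsub hy) hx).hasFDerivWithinAt)
        ((hK.baseGrad_injOn (ball_subset_closedBall hx)).mono hYsub)).symm
    · rw [indicator_of_notMem hx, hslice' x hx, measure_empty]
  rw [hind, lintegral_indicator hBm, lintegral_lintegral_swap hmeas]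
  refine setLIntegral_congr_fun hYm fun y hy => setLIntegral_congr_fun hBm fun x hx => ?_
  rw [det_fderiv_paramGrad hK.contDiffOn (hYsub hy) hx]

/-- The volume is determined by the boundary values of a generating function: the `y`-gradients
agree on the boundary, and their Jacobian determinants are null Lagrangians. -/
theorem holmesThompsonVolume_eq {φ₁ φ₂ : EucSpace (m + 1) → EucSpace (m + 1) → ℝ}
    {K₁ K₂ : EucSpace (m + 1) × EucSpace (m + 1) → ℝ}
    (hφ₁ : IsFinslerMetric φ₁) (hφ₂ : IsFinslerMetric φ₂)
    (h₁ : IsPolarGenerating φ₁ K₁) (h₂ : IsPolarGenerating φ₂ K₂)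
    (h : ∀ y, ∀ x ∈ discBoundary (m + 1), K₁ (y, x) = K₂ (y, x)) :
    holmesThompsonVolume φ₁ = holmesThompsonVolume φ₂ := by
  rw [holmesThompsonVolume, holmesThompsonVolume, h₁.canonicalVolume_unitCoballBundle hφ₁,
    h₂.canonicalVolume_unitCoballBundle hφ₂]
  congr 1
  refine setLIntegral_congr_fun (measurableSet_closedBall.diff (measurableSet_singleton 0))
    fun y hy => ?_
  refine lintegral_abs_det_fderiv_eq_of_eqOn_sphere volume
    (contDiffOn_paramGrad h₁.contDiffOn hy.2) (contDiffOn_paramGrad h₂.contDiffOn hy.2)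
    (fun x hx => ?_) (fun x hx => ?_) (fun x hx => ?_)
  · have : (fun y => K₁ (y, x)) = fun y => K₂ (y, x) := funext fun y => h y x hx
    rw [paramGrad, paramGrad, this]
  · rw [det_fderiv_paramGrad h₁.contDiffOn hy.2 hx]
    exact h₁.det_mixedHessian_ne_zero hφ₁ hy.2 hx
  · rw [det_fderiv_paramGrad h₂.contDiffOn hy.2 hx]
    exact h₂.det_mixedHessian_ne_zero hφ₂ hy.2 hx

end IsPolarGenerating

end Volume

/-! ### Generating functions from enveloping functions -/

section Enveloping

variable {m : ℕ}

/-- The radial projection of `ℝⁿ \ {0}` to the unit sphere, extended by a junk value at the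
origin. -/
noncomputable def sphereProj (y : EucSpace (m + 1)) : sphere (0 : EucSpace (m + 1)) 1 :=
  open Classical in
  if h : y ≠ 0 then ⟨‖y‖⁻¹ • y, by simpa using norm_inv_norm_smul_self h⟩
  else ⟨EuclideanSpace.single 0 1, by simp⟩

theorem coe_sphereProj {y : EucSpace (m + 1)} (hy : y ≠ 0) :
    (sphereProj y : EucSpace (m + 1)) = ‖y‖⁻¹ • y := by
  simp [sphereProj, hy]

theorem sphereProj_coe (q : sphere (0 : EucSpace (m + 1)) 1) :
    sphereProj (q : EucSpace (m + 1)) = q :=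
  Subtype.ext (by rw [coe_sphereProj (ne_zero_of_mem_unit_sphere q)]; simp)

theorem sphereProj_smul {t : ℝ} (ht : 0 < t) (y : EucSpace (m + 1)) :
    sphereProj (t • y) = sphereProj y := by
  rcases eq_or_ne y 0 with rfl | hy
  · simp
  · refine Subtype.ext ?_
    rw [coe_sphereProj hy, coe_sphereProj (smul_ne_zero ht.ne' hy), norm_smul,
      Real.norm_of_nonneg ht.le, smul_smul]
    congr 1
    field_simp

theorem contMDiffOn_sphereProj :
    ContMDiffOn 𝓘(ℝ, EucSpace (m + 1)) (𝓡 m) ∞ (sphereProj (m := m)) {0}ᶜ := by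
  -- the general lemmas on spheres take the dimension of the ambient space as a `Fact`
  have := Fact.mk (@finrank_euclideanSpace_fin ℝ _ (m + 1))
  intro y hy
  let U : TopologicalSpace.Opens (EucSpace (m + 1)) := ⟨{0}ᶜ, isOpen_compl_singleton⟩
  have h1 : ContMDiff 𝓘(ℝ, EucSpace (m + 1)) 𝓘(ℝ, EucSpace (m + 1)) ∞
      fun u : U => ‖(u : EucSpace (m + 1))‖⁻¹ • (u : EucSpace (m + 1)) := by
    intro u
    have hu : (u : EucSpace (m + 1)) ≠ 0 := u.2
    refine contMDiffAt_subtype_iff (f := fun y : EucSpace (m + 1) => ‖y‖⁻¹ • y) |>.2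
      (ContDiffAt.contMDiffAt ?_)
    exact ((contDiffAt_norm ℝ hu).inv (norm_ne_zero_iff.2 hu)).smul contDiffAt_id
  have h2 : ContMDiff 𝓘(ℝ, EucSpace (m + 1)) (𝓡 m) ∞
      fun u : U => sphereProj (u : EucSpace (m + 1)) := by
    refine (h1.codRestrict_sphere (n := m) fun u => ?_).congr fun u => ?_
    · simpa using norm_inv_norm_smul_self (y := (u : EucSpace (m + 1))) u.2
    · exact Subtype.ext (coe_sphereProj u.2)
  exact (contMDiffAt_subtype_iff.1 (h2 ⟨y, hy⟩)).contMDiffWithinAt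

variable {S : Type*} [TopologicalSpace S] [ChartedSpace (EuclideanSpace ℝ (Fin m)) S]

/-- The positively homogeneous extension of an enveloping function, with its parameter space
identified with the unit sphere by `H`. -/
noncomputable def polarExtension (H : S ≃ₘ⟮𝓡 m, 𝓡 m⟯ sphere (0 : EuclideanSpace ℝ (Fin (m + 1))) 1)
    (F : S → EucSpace (m + 1) → ℝ) (z : EucSpace (m + 1) × EucSpace (m + 1)) : ℝ :=
  ‖z.1‖ * F (H.symm (sphereProj z.1)) z.2

theorem IsEnveloping.isPolarGenerating
    (H : S ≃ₘ⟮𝓡 m, 𝓡 m⟯ sphere (0 : EuclideanSpace ℝ (Fin (m + 1))) 1)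
    {φ : EucSpace (m + 1) → EucSpace (m + 1) → ℝ} {F : S → EucSpace (m + 1) → ℝ}
    (hF : IsEnveloping (m := m) φ F) : IsPolarGenerating φ (polarExtension H F) := by
  have := Fact.mk (@finrank_euclideanSpace_fin ℝ _ (m + 1))
  have hunit : ∀ y : EucSpace (m + 1), ‖y‖ = 1 → (fun x => polarExtension H F (y, x))
      = F (H.symm (sphereProj y)) := fun y hy => by
    ext x
    rw [polarExtension, hy, one_mul]
  refine ⟨?_, ?_, ?_, ?_, ?_⟩
  · have h1 : ContMDiffOn (𝓘(ℝ, EucSpace (m + 1)).prod 𝓘(ℝ, EucSpace (m + 1))) (𝓡 m) ∞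
        (fun z : EucSpace (m + 1) × EucSpace (m + 1) => H.symm (sphereProj z.1))
        ({0}ᶜ ×ˢ disc (m + 1)) :=
      H.symm.contMDiff.comp_contMDiffOn
        (contMDiffOn_sphereProj.comp contMDiffOn_fst fun z hz => hz.1)
    have h2 : ContMDiffOn (𝓘(ℝ, EucSpace (m + 1)).prod 𝓘(ℝ, EucSpace (m + 1))) 𝓘(ℝ, ℝ) ∞
        (fun z : EucSpace (m + 1) × EucSpace (m + 1) => F (H.symm (sphereProj z.1)) z.2)
        ({0}ᶜ ×ˢ disc (m + 1)) :=
      hF.smooth.comp (h1.prodMk contMDiffOn_snd) fun z hz => ⟨mem_univ _, hz.2⟩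
    have h3 : ContDiffOn ℝ ∞ (fun z : EucSpace (m + 1) × EucSpace (m + 1) =>
        F (H.symm (sphereProj z.1)) z.2) ({0}ᶜ ×ˢ disc (m + 1)) := by
      rw [← contMDiffOn_iff_contDiffOn, modelWithCornersSelf_prod, ← chartedSpaceSelf_prod]
      exact h2
    refine ContDiffOn.mul (fun z hz => ?_) h3
    exact ((contDiffAt_norm ℝ hz.1).comp z contDiffAt_fst).contDiffWithinAt
  · intro t ht y x
    rw [polarExtension, polarExtension, norm_smul, Real.norm_of_nonneg ht.le,
      sphereProj_smul ht, mul_assoc]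
  · intro x hx y hy
    rw [hunit y hy]
    exact (hF.distanceLike _).dualNorm_eq_one x hx
  · intro x hx α hα
    rw [← (hF.diffeo x hx).range_eq] at hα
    obtain ⟨p, rfl⟩ := hα
    have hp : ‖(H p : EucSpace (m + 1))‖ = 1 := by simp
    refine ⟨H p, hp, ?_⟩
    rw [hunit _ hp, sphereProj_coe, H.symm_apply_apply]
  · intro x hx
    obtain ⟨g, hg, hgF⟩ := (hF.diffeo x hx).smooth_inverse
    refine ⟨fun α => (H (g α) : EucSpace (m + 1)), ?_, fun y hy => ?_⟩
    · have h1 : ContMDiffOn 𝓘(ℝ, Covec (m + 1)) 𝓘(ℝ, EucSpace (m + 1)) ∞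
          (fun α => (H (g α) : EucSpace (m + 1))) (unitCosphere φ x) :=
        (contMDiff_coe_sphere (n := m)).comp_contMDiffOn (H.contMDiff.comp_contMDiffOn hg)
      exact h1.contDiffOn.differentiableOn (by simp)
    · have hy0 : y ≠ 0 := by rintro rfl; simp at hy
      simp only
      rw [hunit y hy, hgF, H.apply_symm_apply, coe_sphereProj hy0, hy, inv_one, one_smul]

end Enveloping

theorem lemma4 {m : ℕ} {S : Type*} [TopologicalSpace S]
    [ChartedSpace (EuclideanSpace ℝ (Fin m)) S] [IsManifold (𝓡 m) ∞ S]
    (hS : Nonempty (S ≃ₘ⟮𝓡 m, 𝓡 m⟯ sphere (0 : EuclideanSpace ℝ (Fin (m + 1))) 1))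
    {φ₁ φ₂ : EucSpace (m + 1) → EucSpace (m + 1) → ℝ}
    (hφ₁ : IsFinslerMetric φ₁) (hφ₂ : IsFinslerMetric φ₂)
    {F₁ F₂ : S → EucSpace (m + 1) → ℝ}
    (hF₁ : IsEnveloping (m := m) φ₁ F₁) (hF₂ : IsEnveloping (m := m) φ₂ F₂)
    (hF : ∀ p : S, ∀ x ∈ discBoundary (m + 1), F₁ p x = F₂ p x) :
    holmesThompsonVolume φ₁ = holmesThompsonVolume φ₂ := by
  obtain ⟨H⟩ := hS
  refine IsPolarGenerating.holmesThompsonVolume_eq hφ₁ hφ₂ (hF₁.isPolarGenerating H)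
    (hF₂.isPolarGenerating H) fun y x hx => ?_
  rw [polarExtension, polarExtension, hF _ x hx]
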